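/- Let $\kappa$ be a regular cardinal (so $\kappa$ is infinite) and let $\mathsf{C}$ be a small category with $\kappa$-small colimits, i.e. with colimits of all diagrams indexed by categories with fewer than $\kappa$ morphisms. Let $\mathrm{Ind}_\kappa(\mathsf{C})$ be the free completion of $\mathsf{C}$ under small $\kappa$-filtered colimits, i.e. the full subcategory of $[\mathsf{C}^{\mathrm{op}},\mathsf{Set}]$ on the presheaves that are colimits of small $\kappa$-filtered diagrams of representable presheaves. Then the following are equivalent: 1. $\mathsf{C}$ is weakly regular: for every commutative square $g f' = f g'$ in $\mathsf{C}$, with $f' : W \to D$, $g' : W \to A$, $f : A \to B$, $g : D \to B$ and $f$ a regular epimorphism, there are an object $\bar W$, morphisms $\bar f : \bar W \to D$ and $\bar g : \bar W \to A$ with $g\bar f = f\bar g$ and $\bar f$ a regular epimorphism, and a morphism $t : W \to \bar W$ with $\bar f t = f'$ and $\bar g t = g'$. 2. $\mathrm{Ind}_\kappa(\mathsf{C})$ is regular: it has finite limits, every kernel pair in it has a coequalizer, and the pullback of a regular epimorphism along any morphism is a regular epimorphism. Here a regular epimorphism is a morphism that is a coequalizer of some pair of parallel morphisms. -/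

import Mathlib

universe w v u

namespace WeaklyRegularInd

open CategoryTheory CategoryTheory.Limits Opposite


/-- A category has `κ`-small colimits if it has colimits of all shapes given by small categories
with fewer than `κ` morphisms. -/
def HasCardinalSmallColimits (C : Type u) [Category.{v} C] (κ : Cardinal.{w}) : Prop :=
  ∀ (J : Type w) [SmallCategory J], HasCardinalLT (Arrow J) κ → HasColimitsOfShape J C

/-- A category is weakly regular if every commutative square
```
  W --f'--> D
  |         |
  g'        g
  v         v
  A --f --> B
```
in which `f` is a regular epimorphism factors, through some `t : W ⟶ W₁`, through a commutative
square on the same cospan whose top side `f₁ : W₁ ⟶ D` is a regular epimorphism. -/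
def IsWeaklyRegular (C : Type u) [Category.{v} C] : Prop :=
  ∀ ⦃W D A B : C⦄ (f' : W ⟶ D) (g' : W ⟶ A) (f : A ⟶ B) (g : D ⟶ B),
    IsRegularEpi f → f' ≫ g = g' ≫ f →
      ∃ (W₁ : C) (f₁ : W₁ ⟶ D) (g₁ : W₁ ⟶ A) (t : W ⟶ W₁),
        IsRegularEpi f₁ ∧ f₁ ≫ g = g₁ ≫ f ∧ t ≫ f₁ = f' ∧ t ≫ g₁ = g'

/-- A presheaf on a small category is a `κ`-ind-object if it is the colimit, in the category of
presheaves, of a small `κ`-filtered diagram of representable presheaves. -/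
def isCardinalIndObject (C : Type w) [SmallCategory C] (κ : Cardinal.{w}) [Fact κ.IsRegular] :
    ObjectProperty (Cᵒᵖ ⥤ Type w) := fun A =>
  ∃ (J : Type w) (_ : SmallCategory J) (_ : IsCardinalFiltered J κ) (F : J ⥤ C)
    (ι : F ⋙ yoneda ⟶ (Functor.const J).obj A), Nonempty (IsColimit (Cocone.mk A ι))

/-- The free completion `Ind_κ(C)` of a small category `C` under small `κ`-filtered colimits: the
full subcategory of presheaves on `C` consisting of the `κ`-ind-objects. -/
abbrev CardinalInd (C : Type w) [SmallCategory C] (κ : Cardinal.{w}) [Fact κ.IsRegular] :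
    Type (w + 1) :=
  (isCardinalIndObject C κ).FullSubcategory

end WeaklyRegularInd

/-!
Suppose that `C` is weakly regular, so that every cospan in `C` with a regular epimorphism `f` on
one side completes to a commutative square whose side opposite to `f` is a regular epimorphism.
Regular epimorphisms then behave like coverings. Call `A ⟶ B` in `Ind_κ(C)` locally surjective if
every `yY ⟶ B` lifts to `A` after restriction along a regular epimorphism of `C`. Locally surjective
morphisms are regular epimorphisms and are stable under pullback. The elements of `B` that lift
locally along a morphism `A ⟶ B` form a `κ`-continuous subpresheaf, because a `κ`-small colimit is
covered by the coproduct of coverings of its terms. Since the ind-objects are the `κ`-continuous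
presheaves, every morphism is a locally surjective one followed by a monomorphism. So every regular
epimorphism is locally surjective, and a kernel pair has the first factor as its coequalizer.

Conversely, let `f` be a regular epimorphism and pull `y f` back along `y g` to a regular
epimorphism `P ⟶ yD`. The object `P` is a `κ`-filtered colimit of representables `yV`, and as `yD`
is `κ`-presentable, one of the composites `yV ⟶ P ⟶ yD` is already a strong epimorphism. The square
completed from `W` then factors through one on `W ⨿ V` whose top side becomes a strong epimorphism
in `Ind_κ(C)`, and `y` reflects regular epimorphisms.
-/

namespace WeaklyRegularInd

open CategoryTheory Limits Opposite

section RegularEpi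

variable {C : Type u} [Category.{v} C]

theorem isRegularEpi_of_comp_eq_π {R A B : C} (f : A ⟶ B) [Epi f] {u v : R ⟶ A}
    (w : u ≫ f = v ≫ f) {c : Cofork u v} (hc : IsColimit c) (r : B ⟶ c.pt) (hr : f ≫ r = c.π) :
    IsRegularEpi f := by
  refine ⟨⟨⟨_, u, v, w, Cofork.IsColimit.mk' _ fun s ↦
    ⟨r ≫ Cofork.IsColimit.desc hc s.π s.condition, ?_, fun hm ↦ ?_⟩⟩⟩⟩
  · simp [reassoc_of% hr]
  · rw [← cancel_epi f, reassoc_of% hr, Cofork.IsColimit.π_desc']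
    exact hm

theorem isRegularEpi_of_family {A B : C} (f : A ⟶ B) [Epi f] {ι : Type*} {R : ι → C}
    [HasCoproduct R] (r s : ∀ i, R i ⟶ A) (w : ∀ i, r i ≫ f = s i ≫ f)
    (h : ∀ ⦃Z : C⦄ (g : A ⟶ Z), (∀ i, r i ≫ g = s i ≫ g) → ∃ u, f ≫ u = g) :
    IsRegularEpi f := by
  have w' : Sigma.desc r ≫ f = Sigma.desc s ≫ f := Sigma.hom_ext _ _ fun i ↦ by simp [w]
  refine ⟨⟨⟨_, Sigma.desc r, Sigma.desc s, w', Cofork.IsColimit.mk' _ fun t ↦ ?_⟩⟩⟩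
  choose u hu using h t.π fun i ↦ by simpa using Sigma.ι R i ≫= t.condition
  refine ⟨u, hu, fun hm ↦ ?_⟩
  rwa [← cancel_epi f, hu]

theorem epi_sigmaDesc_comp_ι {J : Type*} [Category* J] {G : J ⥤ C} {c : Cocone G}
    (hc : IsColimit c) {X : J → C} [HasCoproduct X] (q : ∀ j, X j ⟶ G.obj j) [∀ j, Epi (q j)] :
    Epi (Sigma.desc fun j ↦ q j ≫ c.ι.app j) :=
  ⟨fun a b hab ↦ hc.hom_ext fun j ↦ by
    rw [← cancel_epi (q j)]
    simpa using Sigma.ι X j ≫= hab⟩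

namespace IsWeaklyRegular

theorem exists_square [HasInitial C] (h : IsWeaklyRegular C) {A B D : C} (f : A ⟶ B) (g : D ⟶ B)
    [hf : IsRegularEpi f] :
    ∃ (W : C) (f₁ : W ⟶ D) (g₁ : W ⟶ A), IsRegularEpi f₁ ∧ f₁ ≫ g = g₁ ≫ f := by
  obtain ⟨W, f₁, g₁, -, h₁, h₂, -⟩ :=
    h (initial.to D) (initial.to A) f g hf (initialIsInitial.hom_ext _ _)
  exact ⟨W, f₁, g₁, h₁, h₂⟩

-- A map out of `∐ X` that coequalizes each `q j` descends to the diagram `G` as soon as it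
-- coequalizes, for each `φ : j ⟶ k`, a square covering the pair `(q j ≫ G.map φ, q k)`.
theorem isRegularEpi_sigmaDesc_comp_ι [HasInitial C] (h : IsWeaklyRegular C) {J : Type*}
    [Category* J] [HasCoproductsOfShape (J ⊕ Arrow J) C] {G : J ⥤ C} {c : Cocone G}
    (hc : IsColimit c) {X : J → C} [HasCoproduct X] (q : ∀ j, X j ⟶ G.obj j)
    [∀ j, IsRegularEpi (q j)] : IsRegularEpi (Sigma.desc fun j ↦ q j ≫ c.ι.app j) := by
  choose T t s ht hts using fun φ : Arrow J ↦
    h.exists_square (q φ.right) (q φ.left ≫ G.map φ.hom)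
  have := epi_sigmaDesc_comp_ι hc q
  refine isRegularEpi_of_family _ (R := Sum.elim (fun j ↦ IsRegularEpi.W (q j)) T)
    (Sum.rec (fun j ↦ IsRegularEpi.left (q j) ≫ Sigma.ι X j) fun φ ↦ t φ ≫ Sigma.ι X φ.left)
    (Sum.rec (fun j ↦ IsRegularEpi.right (q j) ≫ Sigma.ι X j) fun φ ↦ s φ ≫ Sigma.ι X φ.right)
    ?_ fun Z g hg ↦ ?_
  · rintro (j | φ)
    · simp [reassoc_of% (IsRegularEpi.w (q j))]
    · simp [← reassoc_of% (hts φ)]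
  · have hd (j : J) : ∃ d : G.obj j ⟶ Z, q j ≫ d = Sigma.ι X j ≫ g :=
      ⟨_, IsRegularEpi.fac (q j) (Sigma.ι X j ≫ g) (by simpa using hg (.inl j))⟩
    choose d hd using hd
    have d_naturality {j k : J} (φ : j ⟶ k) : G.map φ ≫ d k = d j := by
      have hg' : t (Arrow.mk φ) ≫ Sigma.ι X j ≫ g = s (Arrow.mk φ) ≫ Sigma.ι X k ≫ g := by
        simpa using hg (.inr (Arrow.mk φ))
      have hts' : t (Arrow.mk φ) ≫ q j ≫ G.map φ = s (Arrow.mk φ) ≫ q k := hts (Arrow.mk φ)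
      have := ht (Arrow.mk φ)
      rw [← cancel_epi (q j), ← cancel_epi (t (Arrow.mk φ)), reassoc_of% hts', hd, hd, hg']
    exact ⟨hc.desc ⟨Z, ⟨d, fun j k φ ↦ by simpa using d_naturality φ⟩⟩,
      Sigma.hom_ext _ _ fun j ↦ by simp [hd]⟩

end IsWeaklyRegular

end RegularEpi

section Dense

variable {C : Type*} [Category* C] {E : Type*} [Category* E] (F : C ⥤ E)

theorem hom_ext_of_isDense [F.IsDense] {A B : E} {f g : A ⟶ B}
    (h : ∀ (X : C) (x : F.obj X ⟶ A), x ≫ f = x ≫ g) : f = g :=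
  (F.denseAt A).hom_ext' fun X x ↦
    (Category.id_comp _).trans ((h X x).trans (Category.id_comp _).symm)

theorem exists_hom_of_isDense [F.IsDense] {A B : E} (φ : ∀ X : C, (F.obj X ⟶ A) → (F.obj X ⟶ B))
    (hφ : ∀ ⦃X Y : C⦄ (s : X ⟶ Y) (x : F.obj Y ⟶ A), F.map s ≫ φ Y x = φ X (F.map s ≫ x)) :
    ∃ u : A ⟶ B, ∀ (X : C) (x : F.obj X ⟶ A), x ≫ u = φ X x := by
  let c : Cocone (CostructuredArrow.proj F A ⋙ F) :=
    { pt := B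
      ι := { app j := φ j.left j.hom
             naturality j k s := by
               refine Eq.trans ?_ (Category.comp_id _).symm
               exact (hφ s.left k.hom).trans (by rw [CostructuredArrow.w]) } }
  exact ⟨(F.denseAt A).desc c, fun X x ↦
    (congr_arg (· ≫ _) (Category.id_comp x).symm).trans
      ((F.denseAt A).fac c (CostructuredArrow.mk x))⟩

theorem exists_lift_of_mono_of_isDense [F.IsDense] {A B I : E} (f : A ⟶ B) (m : I ⟶ B) [Mono m]
    (h : ∀ (X : C) (x : F.obj X ⟶ A), ∃ z, z ≫ m = x ≫ f) : ∃ e : A ⟶ I, e ≫ m = f := by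
  choose z hz using h
  obtain ⟨e, he⟩ := exists_hom_of_isDense F z fun X Y s x ↦ by simp [← cancel_mono m, hz]
  exact ⟨e, hom_ext_of_isDense F fun X x ↦ by rw [← Category.assoc, he, hz]⟩

theorem isRegularEpi_map [PreservesColimitsOfShape WalkingParallelPair F] {X Y : C} (q : X ⟶ Y)
    [IsRegularEpi q] : IsRegularEpi (F.map q) := by
  obtain ⟨⟨W, l, r, w, hq⟩⟩ := IsRegularEpi.regularEpi (f := q)
  exact ⟨⟨_, F.map l, F.map r, by rw [← F.map_comp, ← F.map_comp, w],
    isColimitCoforkMapOfIsColimit F w hq⟩⟩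

end Dense

section LocallySurjective

variable {C : Type*} [Category* C] {E : Type*} [Category* E] (F : C ⥤ E) {A B : E}

/-- Thinking of the regular epimorphisms of `C` as coverings and of the morphisms `F.obj Y ⟶ B` as
the elements of `B` over `Y`, the element `x` of `B` lifts along `f` after restriction to some
covering of `Y`. -/
def LiftsLocally (f : A ⟶ B) {Y : C} (x : F.obj Y ⟶ B) : Prop :=
  ∃ (X : C) (q : X ⟶ Y) (a : F.obj X ⟶ A), IsRegularEpi q ∧ a ≫ f = F.map q ≫ x

/-- Every element of the target, in the sense of `LiftsLocally`, lifts locally along `f`. For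
presheaves this is local surjectivity for the coverings given by regular epimorphisms. -/
def IsLocallySurjective (f : A ⟶ B) : Prop :=
  ∀ ⦃Y : C⦄ (x : F.obj Y ⟶ B), LiftsLocally F f x

variable {F} {f : A ⟶ B}

theorem LiftsLocally.map_comp [HasInitial C] (h : IsWeaklyRegular C) {X Y : C} {x : F.obj Y ⟶ B}
    (hx : LiftsLocally F f x) (s : X ⟶ Y) : LiftsLocally F f (F.map s ≫ x) := by
  obtain ⟨T, q, a, hq, ha⟩ := hx
  obtain ⟨W, q', s', hq', hW⟩ := h.exists_square q s
  exact ⟨W, q', F.map s' ≫ a, hq', by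
    rw [Category.assoc, ha, ← F.map_comp_assoc, ← F.map_comp_assoc, hW]⟩

theorem LiftsLocally.of_isColimit [HasInitial C] (h : IsWeaklyRegular C) {J : Type*}
    [Category* J] [HasCoproductsOfShape (J ⊕ Arrow J) C] [HasCoproductsOfShape J C]
    [PreservesColimitsOfShape (Discrete J) F] {G : J ⥤ C} {c : Cocone G} (hc : IsColimit c)
    {x : F.obj c.pt ⟶ B} (hx : ∀ j, LiftsLocally F f (F.map (c.ι.app j) ≫ x)) :
    LiftsLocally F f x := by
  choose X q a hq ha using hx
  let hX := isColimitCofanMkObjOfIsColimit F X _ (coproductIsCoproduct X)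
  have fac (j : J) : F.map (Sigma.ι X j) ≫ F.map (Sigma.desc fun j ↦ q j ≫ c.ι.app j) =
      F.map (q j) ≫ F.map (c.ι.app j) := by rw [← F.map_comp, Sigma.ι_desc, F.map_comp]
  refine ⟨∐ X, Sigma.desc fun j ↦ q j ≫ c.ι.app j, Cofan.IsColimit.desc hX a,
    h.isRegularEpi_sigmaDesc_comp_ι hc q, Cofan.IsColimit.hom_ext hX _ _ fun j ↦ ?_⟩
  rw [Cofan.IsColimit.fac_assoc, ha]
  exact (reassoc_of% (fac j)) x |>.symm

namespace IsLocallySurjective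

theorem of_isPullback {P D : E} {fst : P ⟶ A} {snd : P ⟶ D} {g : D ⟶ B}
    (sq : IsPullback fst snd f g) (hf : IsLocallySurjective F f) :
    IsLocallySurjective F snd := fun Y x ↦ by
  obtain ⟨X, q, a, hq, ha⟩ := hf (x ≫ g)
  exact ⟨X, q, sq.lift a (F.map q ≫ x) (by simpa using ha), hq, by simp⟩

variable [PreservesColimitsOfShape WalkingParallelPair F]

theorem exists_extension [HasInitial C] (h : IsWeaklyRegular C) {Y : C} {x : F.obj Y ⟶ B}
    (hx : LiftsLocally F f x) {Z : E} {g : A ⟶ Z}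
    (hg : ∀ ⦃T : E⦄ (u v : T ⟶ A), u ≫ f = v ≫ f → u ≫ g = v ≫ g) :
    ∃ z : F.obj Y ⟶ Z, ∀ ⦃T : C⦄ (t : T ⟶ Y) (a : F.obj T ⟶ A), a ≫ f = F.map t ≫ x →
      F.map t ≫ z = a ≫ g := by
  obtain ⟨X, q, a, hq, ha⟩ := hx
  have := isRegularEpi_map F q
  obtain ⟨z, hz⟩ : ∃ z, F.map q ≫ z = a ≫ g :=
    ⟨_, EffectiveEpi.fac (F.map q) (a ≫ g) fun u v huv ↦ by
      simpa using hg (u ≫ a) (v ≫ a) (by simp [ha, reassoc_of% huv])⟩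
  refine ⟨z, fun T t b hb ↦ ?_⟩
  obtain ⟨W, q', t', hq', hW⟩ := h.exists_square q t
  have := isRegularEpi_map F q'
  have hFW : F.map q' ≫ F.map t = F.map t' ≫ F.map q := by rw [← F.map_comp, hW, F.map_comp]
  rw [← cancel_epi (F.map q'), reassoc_of% hFW, hz]
  simpa using hg (F.map t' ≫ a) (F.map q' ≫ b) (by simp [ha, hb, reassoc_of% hFW])

variable [F.IsDense]

theorem epi (hf : IsLocallySurjective F f) : Epi f :=
  ⟨fun g₁ g₂ hg ↦ hom_ext_of_isDense F fun Y x ↦ by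
    obtain ⟨X, q, a, hq, ha⟩ := hf x
    have := isRegularEpi_map F q
    rw [← cancel_epi (F.map q), ← reassoc_of% ha, ← reassoc_of% ha, hg]⟩

theorem isRegularEpi [HasInitial C] [HasPullback f f] (h : IsWeaklyRegular C)
    (hf : IsLocallySurjective F f) : IsRegularEpi f := by
  have := hf.epi
  refine IsRegularEpi.of_epi_of_exists fun Z g hg ↦ ?_
  have hg' ⦃T : E⦄ (u v : T ⟶ A) (huv : u ≫ f = v ≫ f) : u ≫ g = v ≫ g := by
    simpa only [pullback.lift_fst_assoc, pullback.lift_snd_assoc] using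
      pullback.lift u v huv ≫= hg
  choose φ hφ using fun Y x ↦ exists_extension (Y := Y) h (hf x) hg'
  obtain ⟨u, hu⟩ := exists_hom_of_isDense F φ fun X Y s x ↦ by
    obtain ⟨T, q, a, hq, ha⟩ := hf (F.map s ≫ x)
    have := isRegularEpi_map F q
    rw [← cancel_epi (F.map q), hφ _ _ q a ha, ← F.map_comp_assoc,
      hφ _ _ (q ≫ s) a (by simpa using ha)]
  refine ⟨u, hom_ext_of_isDense F fun Y a ↦ ?_⟩
  rw [← Category.assoc, hu]
  simpa using hφ Y (a ≫ f) (𝟙 Y) a (by simp)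

end IsLocallySurjective

theorem isLocallySurjective_of_isRegularEpi {I : E} (f : A ⟶ B) [IsRegularEpi f] (e : A ⟶ I)
    (m : I ⟶ B) [Mono m] (fac : e ≫ m = f) (he : IsLocallySurjective F e) :
    IsLocallySurjective F f := by
  have : StrongEpi (e ≫ m) := by rw [fac]; infer_instance
  have := strongEpi_of_strongEpi e m
  have := isIso_of_mono_of_strongEpi m
  intro Y x
  obtain ⟨X, q, a, hq, ha⟩ := he (x ≫ inv m)
  exact ⟨X, q, a, hq, by rw [← fac, reassoc_of% ha]; simp⟩

theorem regular_of_exists_image [HasInitial C] (h : IsWeaklyRegular C) [F.IsDense]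
    [PreservesColimitsOfShape WalkingParallelPair F] [HasFiniteLimits E]
    (exists_image : ∀ ⦃A B : E⦄ (f : A ⟶ B), ∃ (I : E) (e : A ⟶ I) (m : I ⟶ B),
      IsLocallySurjective F e ∧ Mono m ∧ e ≫ m = f) : Regular E where
  hasCoequalizer_of_isKernelPair {X Y Z f g₁ g₂} hk := by
    obtain ⟨I, e, m, he, _, rfl⟩ := exists_image f
    have := he.isRegularEpi h
    have hk' : IsKernelPair e g₁ g₂ := hk.cancel_right_of_mono
    exact ⟨⟨_, hk'.toCoequalizer'⟩⟩
  regularEpiIsStableUnderBaseChange := ⟨fun {X Y Y' S f g f' g'} sq (hg : IsRegularEpi g) ↦ by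
    obtain ⟨I, e, m, he, _, fac⟩ := exists_image g
    exact ((isLocallySurjective_of_isRegularEpi g e m fac he).of_isPullback sq).isRegularEpi h⟩

end LocallySurjective

section Presentable

variable (κ : Cardinal.{w}) [Fact κ.IsRegular] {C : Type w} [SmallCategory C]
  {E : Type u} [Category.{w} E] (F : C ⥤ E) [∀ X, IsCardinalPresentable (F.obj X) κ]

section Dense

variable [F.IsDense]

include κ F in
theorem mono_of_isColimit_of_mono {J : Type w} [SmallCategory J] [IsCardinalFiltered J κ]
    {G : J ⥤ E} {c : Cocone G} (hc : IsColimit c) {X : E} (m : c.pt ⟶ X)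
    [∀ j, Mono (c.ι.app j ≫ m)] : Mono m where
  right_cancellation g h hgh := hom_ext_of_isDense F fun Y y ↦ by
    have := isFiltered_of_isCardinalFiltered J κ
    obtain ⟨i, g', hg'⟩ := IsCardinalPresentable.exists_hom_of_isColimit κ hc (y ≫ g)
    obtain ⟨j, h', hh'⟩ := IsCardinalPresentable.exists_hom_of_isColimit κ hc (y ≫ h)
    have hk : g' ≫ G.map (IsFiltered.leftToMax i j) = h' ≫ G.map (IsFiltered.rightToMax i j) := by
      rw [← cancel_mono (c.ι.app (IsFiltered.max i j) ≫ m)]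
      simp [reassoc_of% hg', reassoc_of% hh', hgh]
    rw [← hg', ← hh', ← c.w (IsFiltered.leftToMax i j), ← c.w (IsFiltered.rightToMax i j),
      reassoc_of% hk]

variable [∀ Y, IsCardinalFiltered (CostructuredArrow F Y) κ] [HasCardinalFilteredColimits E κ]

include κ in
-- The images of the composites of `e` with morphisms from objects `F.obj V` form a `κ`-filtered
-- diagram with colimit `F.obj D`, so by presentability one of these images is all of `F.obj D`.
theorem exists_strongEpi_comp [Regular E] {P : E} {D : C} (e : P ⟶ F.obj D) [StrongEpi e] :
    ∃ (V : C) (p : F.obj V ⟶ P), StrongEpi (p ≫ e) := by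
  let J := CostructuredArrow F P
  let arrows : J ⥤ Arrow E :=
    { obj j := Arrow.mk (j.hom ≫ e)
      map φ := Arrow.homMk (F.map φ.left) (𝟙 _) (by simp) }
  let images : J ⥤ E := arrows ⋙ im
  have := HasCardinalFilteredColimits.hasColimitsOfShape κ (C := E) J
  let m : colimit images ⟶ F.obj D := colimit.desc images
    { pt := F.obj D
      ι := { app j := image.ι (j.hom ≫ e)
             naturality j k φ := image.map_ι (arrows.map φ) } }
  let incl (j : J) : image (j.hom ≫ e) ⟶ colimit images := colimit.ι images j
  have incl_m (j : J) : incl j ≫ m = image.ι (j.hom ≫ e) := colimit.ι_desc _ _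
  have (j : J) : Mono ((colimit.cocone images).ι.app j ≫ m) :=
    (incl_m j).symm ▸ inferInstanceAs (Mono (image.ι (j.hom ≫ e)))
  have : Mono m := mono_of_isColimit_of_mono κ F (colimit.isColimit images) m
  obtain ⟨e', fac⟩ := exists_lift_of_mono_of_isDense F e m fun X x ↦
    ⟨factorThruImage (x ≫ e) ≫ incl (CostructuredArrow.mk x), by
      rw [Category.assoc, incl_m]
      exact image.fac (x ≫ e)⟩
  have : StrongEpi (e' ≫ m) := by rwa [fac]
  have := strongEpi_of_strongEpi e' m
  have := isIso_of_mono_of_strongEpi m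
  obtain ⟨j, s, hs⟩ : ∃ (j : J) (s : F.obj D ⟶ image (j.hom ≫ e)), s ≫ incl j = inv m :=
    IsCardinalPresentable.exists_hom_of_isColimit κ (colimit.isColimit images) (inv m)
  have : IsSplitEpi (image.ι (j.hom ≫ e)) :=
    ⟨⟨⟨s, by rw [← incl_m, reassoc_of% hs, IsIso.inv_hom_id]⟩⟩⟩
  refine ⟨j.left, j.hom, ?_⟩
  rw [← image.fac (j.hom ≫ e)]
  exact strongEpi_comp _ _

end Dense

variable {F} in
theorem exists_comp_eq_app_of_isColimit [F.Full] [F.Faithful] {J : Type w} [SmallCategory J]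
    [IsCardinalFiltered J κ] {A B : C} (f : A ⟶ B) {Q : J ⥤ C} (π : (Functor.const J).obj A ⟶ Q)
    {c : Cocone (Q ⋙ F)} (hc : IsColimit c) (b : F.obj B ⟶ c.pt)
    (hb : ∀ j, F.map f ≫ b = F.map (π.app j) ≫ c.ι.app j) :
    ∃ (k : J) (r : B ⟶ Q.obj k), f ≫ r = π.app k := by
  obtain ⟨j, b', hb'⟩ := IsCardinalPresentable.exists_hom_of_isColimit κ hc b
  obtain ⟨t, rfl⟩ := F.map_surjective b'
  obtain ⟨k, φ, hk⟩ := IsCardinalPresentable.exists_eq_of_isColimit' κ hc (F.map (f ≫ t))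
    (F.map (π.app j)) (by rw [F.map_comp, Category.assoc, hb', hb])
  refine ⟨k, t ≫ Q.map φ, F.map_injective ?_⟩
  have hπ : π.app j ≫ Q.map φ = π.app k := by simpa using (π.naturality φ).symm
  rw [← Category.assoc, F.map_comp]
  refine hk.trans ?_
  rw [← hπ, F.map_comp]
  rfl

-- The map `F.map f` is the coequalizer of some `R ⇉ F.obj A`, and `R` is the `κ`-filtered colimit
-- of objects `F.obj X`. Hence `F.obj B` maps to the `κ`-filtered colimit of the images under `F` of
-- the coequalizers of the induced pairs `X ⇉ A`, and by presentability to one of them.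
theorem isRegularEpi_of_isRegularEpi_map [HasCoequalizers C] [F.Full] [F.Faithful] [F.IsDense]
    [∀ Y, IsCardinalFiltered (CostructuredArrow F Y) κ] [HasCardinalFilteredColimits E κ]
    {A B : C} (f : A ⟶ B) [IsRegularEpi (F.map f)] : IsRegularEpi f := by
  let J := CostructuredArrow F (IsRegularEpi.W (F.map f))
  have := isFiltered_of_isCardinalFiltered J κ
  have := HasCardinalFilteredColimits.hasColimitsOfShape κ (C := E) J
  have : Epi f := F.epi_of_epi_map inferInstance
  choose u hu using fun j : J ↦ F.map_surjective (j.hom ≫ IsRegularEpi.left (F.map f))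
  choose v hv using fun j : J ↦ F.map_surjective (j.hom ≫ IsRegularEpi.right (F.map f))
  have map_u {j k : J} (φ : j ⟶ k) : φ.left ≫ u k = u j := F.map_injective (by simp [hu])
  have map_v {j k : J} (φ : j ⟶ k) : φ.left ≫ v k = v j := F.map_injective (by simp [hv])
  have huv (j : J) : u j ≫ f = v j ≫ f := F.map_injective (by simp [hu, hv, IsRegularEpi.w])
  let Q : J ⥤ C :=
    { obj j := coequalizer (u j) (v j)
      map {j k} φ := coequalizer.desc (coequalizer.π (u k) (v k)) (by
        rw [← map_u φ, ← map_v φ, Category.assoc, coequalizer.condition, Category.assoc])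
      map_id j := by ext; simp
      map_comp φ ψ := by ext; simp }
  let π : (Functor.const J).obj A ⟶ Q := { app j := coequalizer.π (u j) (v j) }
  let p : (Functor.const J).obj (F.obj A) ⟶ (Functor.const J).obj (colimit (Q ⋙ F)) :=
    (Functor.constComp J A F).inv ≫ Functor.whiskerRight π F ≫ (colimit.cocone (Q ⋙ F)).ι
  have hp (j : J) : p.app j = F.map (π.app j) ≫ colimit.ι (Q ⋙ F) j := by simp [p]
  obtain ⟨j₀⟩ := IsFiltered.nonempty (C := J)
  have := IsFiltered.isConnected J
  have p_eq (j : J) : p.app j₀ = p.app j := nat_trans_from_is_connected p j₀ j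
  have hp₀ : IsRegularEpi.left (F.map f) ≫ p.app j₀ = IsRegularEpi.right (F.map f) ≫ p.app j₀ :=
    hom_ext_of_isDense F fun X x ↦ by
      let j : J := CostructuredArrow.mk x
      have hl : F.map (u j) = x ≫ IsRegularEpi.left (F.map f) := hu j
      have hr : F.map (v j) = x ≫ IsRegularEpi.right (F.map f) := hv j
      rw [← reassoc_of% hl, ← reassoc_of% hr, p_eq j, hp, ← F.map_comp_assoc, ← F.map_comp_assoc]
      simp only [π, coequalizer.condition]
  obtain ⟨k, r, hr⟩ := exists_comp_eq_app_of_isColimit κ f π (colimit.isColimit (Q ⋙ F))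
    (IsRegularEpi.desc (F.map f) (p.app j₀) hp₀) fun j ↦
      (IsRegularEpi.fac _ _ hp₀).trans ((p_eq j).trans (hp j))
  exact isRegularEpi_of_comp_eq_π f (huv k) (coequalizerIsCoequalizer (u k) (v k)) r hr

theorem isWeaklyRegular_of_regular [HasCoequalizers C] [HasBinaryCoproducts C] [F.Full]
    [F.Faithful] [F.IsDense] [PreservesColimitsOfShape WalkingParallelPair F]
    [PreservesColimitsOfShape (Discrete WalkingPair) F]
    [∀ Y, IsCardinalFiltered (CostructuredArrow F Y) κ] [HasCardinalFilteredColimits E κ]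
    [Regular E] : IsWeaklyRegular C := by
  intro W D A B f' g' f g _ hw
  have := isRegularEpi_map F f
  let fst := pullback.fst (F.map g) (F.map f)
  let snd := pullback.snd (F.map g) (F.map f)
  obtain ⟨V, p, hp⟩ := exists_strongEpi_comp κ F fst
  let p₀ : F.obj W ⟶ pullback (F.map g) (F.map f) :=
    pullback.lift (F.map f') (F.map g') (by rw [← F.map_comp, ← F.map_comp, hw])
  obtain ⟨q, hq₀, hq⟩ : ∃ q, F.map coprod.inl ≫ q = p₀ ∧ F.map coprod.inr ≫ q = p := by
    obtain ⟨q, hq₀, hq⟩ := BinaryCofan.IsColimit.desc'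
      (isColimitOfHasBinaryCoproductOfPreservesColimit F W V) p₀ p
    exact ⟨q, hq₀, hq⟩
  obtain ⟨f₁, hf₁⟩ := F.map_surjective (q ≫ fst)
  obtain ⟨g₁, hg₁⟩ := F.map_surjective (q ≫ snd)
  have : StrongEpi (F.map coprod.inr ≫ F.map f₁) := by rwa [hf₁, reassoc_of% hq]
  have := strongEpi_of_strongEpi (F.map coprod.inr) (F.map f₁)
  refine ⟨W ⨿ V, f₁, g₁, coprod.inl, isRegularEpi_of_isRegularEpi_map κ F f₁,
    F.map_injective ?_, F.map_injective ?_, F.map_injective ?_⟩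
  · simp [hf₁, hg₁, fst, snd, pullback.condition]
  · rw [F.map_comp, hf₁, reassoc_of% hq₀]
    exact pullback.lift_fst _ _ _
  · rw [F.map_comp, hg₁, reassoc_of% hq₀]
    exact pullback.lift_snd _ _ _

end Presentable

section Composition

variable {C : Type*} [Category* C] {D E : Type*} [Category.{v} D] [Category.{v} E]

theorem isDense_of_comp (F : C ⥤ D) (G : D ⥤ E) [G.Full] [G.Faithful] [(F ⋙ G).IsDense] :
    F.IsDense where
  isDenseAt Y := ⟨isColimitOfReflects G <| IsColimit.ofIsoColimit
    (IsColimit.whiskerEquivalence ((F ⋙ G).denseAt (G.obj Y))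
      (CostructuredArrow.post F G Y).asEquivalence) <| Cocone.ext (Iso.refl _) fun _ ↦
        (Category.comp_id _).trans ((Category.id_comp _).trans
          (congr_arg G.map (Category.id_comp _)).symm)⟩

variable (κ : Cardinal.{w}) [Fact κ.IsRegular]

theorem isCardinalFiltered_costructuredArrow_of_comp (F : C ⥤ D) (G : D ⥤ E) [G.Full]
    [G.Faithful] (Y : D) [IsCardinalFiltered (CostructuredArrow (F ⋙ G) (G.obj Y)) κ] :
    IsCardinalFiltered (CostructuredArrow F Y) κ :=
  .of_equivalence κ (CostructuredArrow.post F G Y).asEquivalence.symm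

theorem isCardinalPresentable_of_obj (G : D ⥤ E) [G.Full] [G.Faithful]
    [G.IsCardinalAccessible κ] (X : D) [IsCardinalPresentable (G.obj X) κ] :
    IsCardinalPresentable X κ where
  preservesColimitOfShape J _ _ := by
    have := G.preservesColimitsOfShape_of_isCardinalAccessible κ J
    have := preservesColimitsOfShape_of_isCardinalPresentable (G.obj X) κ J
    exact preservesColimitsOfShape_of_natIso (F := G ⋙ coyoneda.obj (op (G.obj X)))
      (NatIso.ofComponents fun Y ↦
        ((Functor.FullyFaithful.ofFullyFaithful G).homEquiv (X := X) (Y := Y)).symm.toIso)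

end Composition

theorem hasCardinalLT_arrow_of_finCategory (J : Type w) [SmallCategory J] [FinCategory J]
    (κ : Cardinal.{w}) [Fact κ.IsRegular] : HasCardinalLT (Arrow J) κ :=
  .of_le (by rw [hasCardinalLT_aleph0_iff]; infer_instance)
    (Cardinal.IsRegular.aleph0_le Fact.out)

theorem HasCardinalSmallColimits.hasFiniteColimits {C : Type u} [Category.{v} C]
    {κ : Cardinal.{w}} [Fact κ.IsRegular] (hC : HasCardinalSmallColimits.{w} C κ) :
    HasFiniteColimits C :=
  hasFiniteColimits_of_hasFiniteColimits_of_size C fun J _ _ ↦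
    hC J (hasCardinalLT_arrow_of_finCategory J κ)

section Continuous

variable {C : Type w} [SmallCategory C] (κ : Cardinal.{w})

/-- The `κ`-continuous presheaves on `C`: those sending the `κ`-small colimits that exist in `C` to
limits. Shapes are written `Jᵒᵖ` because the colimits of shape `J` in `C` are the limits of shape
`Jᵒᵖ` in `Cᵒᵖ`. -/
def IsCardinalContinuous : ObjectProperty (Cᵒᵖ ⥤ Type w) := fun A ↦
  ∀ (J : Type w) [SmallCategory J], HasCardinalLT (Arrow J) κ → PreservesLimitsOfShape Jᵒᵖ A

theorem isCardinalContinuous_yoneda_obj (X : C) : IsCardinalContinuous κ (yoneda.obj X) :=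
  fun _ _ _ ↦ inferInstance

instance isClosedUnderLimitsOfShape_isCardinalContinuous (K : Type*) [Category* K] :
    (IsCardinalContinuous (C := C) κ).IsClosedUnderLimitsOfShape K where
  limitsOfShape_le := fun A ⟨p⟩ J _ hJ ↦ by
    change ObjectProperty.preservesLimitsOfShape Jᵒᵖ A
    have h (k : K) : ObjectProperty.preservesLimitsOfShape Jᵒᵖ (p.diag.obj k) :=
      p.prop_diag_obj k J hJ
    rw [Presheaf.preservesLimitsOfShape_eq_isLocal] at h ⊢
    exact ObjectProperty.prop_of_isLimit _ p.isLimit h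

variable [Fact κ.IsRegular]

instance isCardinalPresentable_shrinkYoneda_obj (X : C) :
    IsCardinalPresentable (shrinkYoneda.{w}.obj X) κ :=
  isCardinalPresentable_of_iso (uliftYonedaIsoShrinkYoneda.{w}.app X) κ

instance isClosedUnderColimitsOfShape_isCardinalContinuous (K : Type w) [SmallCategory K]
    [IsCardinalFiltered K κ] :
    (IsCardinalContinuous (C := C) κ).IsClosedUnderColimitsOfShape K where
  colimitsOfShape_le := fun A ⟨p⟩ J _ hJ ↦ by
    change ObjectProperty.preservesLimitsOfShape Jᵒᵖ A
    have h (k : K) : ObjectProperty.preservesLimitsOfShape Jᵒᵖ (p.diag.obj k) :=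
      p.prop_diag_obj k J hJ
    rw [Presheaf.preservesLimitsOfShape_eq_isLocal] at h ⊢
    have := MorphismProperty.isClosedUnderColimitsOfShape_isLocal
      (⨆ F : Jᵒᵖ ⥤ Cᵒᵖ, MorphismProperty.ofHoms (Presheaf.preservesLimitHomFamily F)) K κ
      fun X Y f hf ↦ by
        simp only [MorphismProperty.iSup_iff] at hf
        obtain ⟨F, ⟨hF⟩⟩ := hf
        have (j : Jᵒᵖᵒᵖ) : IsCardinalPresentable ((F.leftOp ⋙ shrinkYoneda.{w}).obj j) κ :=
          isCardinalPresentable_shrinkYoneda_obj κ (F.leftOp.obj j)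
        exact ⟨isCardinalPresentable_of_isColimit _
          (colimit.isColimit (F.leftOp ⋙ shrinkYoneda.{w})) κ (by simpa using hJ),
          isCardinalPresentable_shrinkYoneda_obj κ _⟩
    exact ObjectProperty.prop_of_isColimit _ p.isColimit h

variable {κ} in
theorem isCardinalFiltered_costructuredArrow_yoneda
    (hC : HasCardinalSmallColimits.{w, w, w} C κ) {A : Cᵒᵖ ⥤ Type w}
    (hA : IsCardinalContinuous κ A) : IsCardinalFiltered (CostructuredArrow yoneda A) κ := by
  suffices IsCardinalFiltered A.Elementsᵒᵖ κ from
    .of_equivalence κ (CategoryOfElements.costructuredArrowYonedaEquivalence A)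
  refine ⟨fun {J} _ K hJ ↦ ?_⟩
  have := hC J hJ
  have : HasLimitsOfShape Jᵒᵖ Cᵒᵖ := hasLimitsOfShape_opposite_opposite_iff.2 this
  have := hA J hJ
  have : HasColimitsOfShape J A.Elementsᵒᵖ := hasColimitsOfShape_op_of_hasLimitsOfShape
  exact ⟨colimit.cocone K⟩

theorem isCardinalIndObject_of_isCardinalFiltered (A : Cᵒᵖ ⥤ Type w)
    [IsCardinalFiltered (CostructuredArrow yoneda A) κ] : isCardinalIndObject C κ A :=
  ⟨CostructuredArrow yoneda A, inferInstance, inferInstance, CostructuredArrow.proj _ _, _,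
    ⟨Presheaf.isColimitTautologicalCocone A⟩⟩

variable {κ} in
theorem isCardinalIndObject_eq (hC : HasCardinalSmallColimits.{w, w, w} C κ) :
    isCardinalIndObject C κ = IsCardinalContinuous κ := by
  ext A
  constructor
  · rintro ⟨J, _, _, F, ι, ⟨hι⟩⟩
    exact (IsCardinalContinuous κ).prop_of_isColimit hι fun j ↦
      isCardinalContinuous_yoneda_obj κ _
  · intro hA
    have := isCardinalFiltered_costructuredArrow_yoneda hC hA
    exact isCardinalIndObject_of_isCardinalFiltered κ A

end Continuous

theorem preservesColimitsOfShape_of_forall_comp_yoneda {C : Type*} [Category* C] {E : Type*}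
    [Category* E] (F : C ⥤ E) (J : Type*) [Category* J]
    [∀ Z : E, PreservesLimitsOfShape Jᵒᵖ (F.op ⋙ yoneda.obj Z)] :
    PreservesColimitsOfShape J F where
  preservesColimit := ⟨fun {c} hc ↦ ⟨(Cocone.isColimitYonedaEquiv (F.mapCocone c)).symm fun Z ↦
    isLimitOfPreserves (F.op ⋙ yoneda.obj Z) hc.op⟩⟩

theorem preservesLimit_toFunctor {D : Type*} [Category* D] {J : Type*} [Category* J] {K : J ⥤ D}
    {B : D ⥤ Type w} (S : Subfunctor B) [PreservesLimit K B]
    (hS : ∀ ⦃c : Cone K⦄, IsLimit c → ∀ x : B.obj c.pt,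
      (∀ j, B.map (c.π.app j) x ∈ S.obj (K.obj j)) → x ∈ S.obj c.pt) :
    PreservesLimit K S.toFunctor where
  preserves {c} hc := (Types.isLimit_iff _).2 fun s hs ↦ by
    obtain ⟨x, hx, hx_unique⟩ := (Types.isLimit_iff _).1 ⟨isLimitOfPreserves B hc⟩
      (fun j ↦ (s j).1) fun φ ↦ congr_arg Subtype.val (hs φ)
    have hxS (j : J) : B.map (c.π.app j) x ∈ S.obj (K.obj j) :=
      Set.mem_of_eq_of_mem (hx j) (s j).2
    exact ⟨⟨x, hS hc x hxS⟩, fun j ↦ Subtype.ext (hx j), fun y hy ↦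
      Subtype.ext (hx_unique y.1 fun j ↦ congr_arg Subtype.val (hy j))⟩

namespace CardinalInd

variable {C : Type w} [SmallCategory C] {κ : Cardinal.{w}} [Fact κ.IsRegular]

variable (C κ) in
/-- The Yoneda embedding with values in `κ`-ind-objects. -/
def yoneda : C ⥤ CardinalInd C κ :=
  (isCardinalIndObject C κ).lift CategoryTheory.yoneda fun X ↦
    have : IsCardinalFiltered (CostructuredArrow CategoryTheory.yoneda
        (CategoryTheory.yoneda.obj X)) κ :=
      CostructuredArrow.mkIdTerminal.isCardinalFiltered κ
    isCardinalIndObject_of_isCardinalFiltered κ _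

instance : (yoneda C κ).Full := inferInstanceAs (ObjectProperty.lift _ _ _).Full

instance : (yoneda C κ).Faithful := inferInstanceAs (ObjectProperty.lift _ _ _).Faithful

instance : (yoneda C κ).IsDense :=
  have : (yoneda C κ ⋙ (isCardinalIndObject C κ).ι).IsDense :=
    inferInstanceAs CategoryTheory.yoneda.IsDense
  isDense_of_comp _ (isCardinalIndObject C κ).ι

/-- The Yoneda lemma for `κ`-ind-objects: the elements of `A` over `X` as morphisms to `A`. -/
def yonedaEquiv {A : CardinalInd C κ} {X : C} :
    ((yoneda C κ).obj X ⟶ A) ≃ A.obj.obj (op X) :=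
  (isCardinalIndObject C κ).fullyFaithfulι.homEquiv.trans CategoryTheory.yonedaEquiv

theorem yonedaEquiv_comp {A B : CardinalInd C κ} {X : C} (x : (yoneda C κ).obj X ⟶ A)
    (f : A ⟶ B) : yonedaEquiv (x ≫ f) = f.hom.app (op X) (yonedaEquiv x) :=
  CategoryTheory.yonedaEquiv_comp x.hom f.hom

theorem map_yonedaEquiv {A : CardinalInd C κ} {X Y : C} (x : (yoneda C κ).obj Y ⟶ A)
    (s : X ⟶ Y) : A.obj.map s.op (yonedaEquiv x) = yonedaEquiv ((yoneda C κ).map s ≫ x) :=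
  yonedaEquiv_naturality x.hom s

/-- The natural form of `yonedaEquiv`. -/
def yonedaOpCompYonedaObjIso (A : CardinalInd C κ) :
    (yoneda C κ).op ⋙ CategoryTheory.yoneda.obj A ≅ A.obj :=
  NatIso.ofComponents (fun _ ↦ yonedaEquiv.toIso) fun s ↦ by
    ext x
    exact (map_yonedaEquiv x s.unop).symm

section

variable (hC : HasCardinalSmallColimits.{w, w, w} C κ)

include hC

theorem isCardinalContinuous_obj (A : CardinalInd C κ) : IsCardinalContinuous κ A.obj :=
  (isCardinalIndObject_eq hC).le _ A.property

theorem isCardinalFiltered_costructuredArrow (A : CardinalInd C κ) :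
    IsCardinalFiltered (CostructuredArrow (yoneda C κ) A) κ :=
  have : IsCardinalFiltered (CostructuredArrow (yoneda C κ ⋙ (isCardinalIndObject C κ).ι)
      ((isCardinalIndObject C κ).ι.obj A)) κ :=
    isCardinalFiltered_costructuredArrow_yoneda hC (isCardinalContinuous_obj hC A)
  isCardinalFiltered_costructuredArrow_of_comp κ _ (isCardinalIndObject C κ).ι A

theorem hasFiniteLimits : HasFiniteLimits (CardinalInd C κ) where
  out K _ _ := by
    have : (isCardinalIndObject C κ).IsClosedUnderLimitsOfShape K := by
      rw [isCardinalIndObject_eq hC]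
      infer_instance
    infer_instance

theorem isClosedUnderColimitsOfShape (K : Type w) [SmallCategory K] [IsCardinalFiltered K κ] :
    (isCardinalIndObject C κ).IsClosedUnderColimitsOfShape K := by
  rw [isCardinalIndObject_eq hC]
  infer_instance

theorem hasCardinalFilteredColimits : HasCardinalFilteredColimits (CardinalInd C κ) κ where
  hasColimitsOfShape K _ _ :=
    have := isClosedUnderColimitsOfShape hC K
    inferInstance

theorem isCardinalPresentable_yoneda_obj (X : C) :
    IsCardinalPresentable ((yoneda C κ).obj X) κ := by
  have : (isCardinalIndObject C κ).ι.IsCardinalAccessible κ := ⟨fun K _ _ ↦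
    have := isClosedUnderColimitsOfShape hC K
    inferInstance⟩
  have : IsCardinalPresentable ((isCardinalIndObject C κ).ι.obj ((yoneda C κ).obj X)) κ :=
    isCardinalPresentable_of_iso (uliftYonedaIsoYoneda.{w}.app X) κ
  exact isCardinalPresentable_of_obj κ (isCardinalIndObject C κ).ι _

theorem preservesColimitsOfShape_yoneda {J : Type w} [SmallCategory J]
    (hJ : HasCardinalLT (Arrow J) κ) : PreservesColimitsOfShape J (yoneda C κ) :=
  have (A : CardinalInd C κ) :
      PreservesLimitsOfShape Jᵒᵖ ((yoneda C κ).op ⋙ CategoryTheory.yoneda.obj A) :=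
    have := isCardinalContinuous_obj hC A J hJ
    preservesLimitsOfShape_of_natIso (yonedaOpCompYonedaObjIso A).symm
  preservesColimitsOfShape_of_forall_comp_yoneda _ J

theorem preservesFiniteColimits_yoneda : PreservesFiniteColimits (yoneda C κ) :=
  preservesFiniteColimits_of_preservesFiniteColimitsOfSize.{w} _ fun _ _ _ ↦
    preservesColimitsOfShape_yoneda hC (hasCardinalLT_arrow_of_finCategory _ κ)

end

/-- The subpresheaf of `B` consisting of the elements that lift locally along `f`, which is the
image of `f` in `CardinalInd C κ`. -/
def locallyLiftable [HasInitial C] (h : IsWeaklyRegular C) {A B : CardinalInd C κ} (f : A ⟶ B) :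
    Subfunctor B.obj where
  obj U := {x | LiftsLocally (yoneda C κ) f (yonedaEquiv (X := U.unop).symm x)}
  map s x hx := by
    obtain ⟨x, rfl⟩ := yonedaEquiv.surjective x
    rw [Set.mem_ofPred_eq, Equiv.symm_apply_apply] at hx
    have := hx.map_comp h s.unop
    rwa [← yonedaEquiv.symm_apply_apply (_ ≫ x), ← map_yonedaEquiv] at this

theorem yonedaEquiv_mem_locallyLiftable_iff [HasInitial C] (h : IsWeaklyRegular C)
    {A B : CardinalInd C κ} (f : A ⟶ B) {X : C} (x : (yoneda C κ).obj X ⟶ B) :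
    yonedaEquiv x ∈ (locallyLiftable h f).obj (op X) ↔ LiftsLocally (yoneda C κ) f x := by
  conv_rhs => rw [← yonedaEquiv.symm_apply_apply x]
  rfl

theorem isCardinalContinuous_locallyLiftable [HasInitial C]
    (hC : HasCardinalSmallColimits.{w, w, w} C κ) (h : IsWeaklyRegular C)
    {A B : CardinalInd C κ} (f : A ⟶ B) :
    IsCardinalContinuous κ (locallyLiftable h f).toFunctor := fun J _ hJ ↦
  ⟨fun {K} ↦ by
    have hJ' : HasCardinalLT J κ := hasCardinalLT_of_hasCardinalLT_arrow hJ
    have : HasCoproductsOfShape (J ⊕ Arrow J) C := hC _ <| by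
      simpa using (hasCardinalLT_sum_iff _ _ κ (Cardinal.IsRegular.aleph0_le Fact.out)).2 ⟨hJ', hJ⟩
    have : HasCoproductsOfShape J C := hC _ (by simpa using hJ')
    have : PreservesColimitsOfShape (Discrete J) (yoneda C κ) :=
      preservesColimitsOfShape_yoneda hC (by simpa using hJ')
    have := isCardinalContinuous_obj hC B J hJ
    refine preservesLimit_toFunctor _ fun c hc x hx ↦ ?_
    obtain ⟨x, rfl⟩ := yonedaEquiv.surjective x
    refine (yonedaEquiv_mem_locallyLiftable_iff h f x).2
      (.of_isColimit h (isColimitCoconeUnopOfCone K hc) fun j ↦ ?_)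
    refine (yonedaEquiv_mem_locallyLiftable_iff h f _).1 ?_
    rw [← map_yonedaEquiv]
    exact hx (op j)⟩

theorem exists_image [HasInitial C] (hC : HasCardinalSmallColimits.{w, w, w} C κ)
    (h : IsWeaklyRegular C) {A B : CardinalInd C κ} (f : A ⟶ B) :
    ∃ (I : CardinalInd C κ) (e : A ⟶ I) (m : I ⟶ B),
      IsLocallySurjective (yoneda C κ) e ∧ Mono m ∧ e ≫ m = f := by
  let S := locallyLiftable h f
  have hI : isCardinalIndObject C κ S.toFunctor :=
    (isCardinalIndObject_eq hC).ge _ (isCardinalContinuous_locallyLiftable hC h f)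
  let m : (⟨S.toFunctor, hI⟩ : CardinalInd C κ) ⟶ B := ObjectProperty.homMk S.ι
  have : Mono m := (isCardinalIndObject C κ).ι.mono_of_mono_map (inferInstanceAs (Mono S.ι))
  have exists_comp_m_iff {X : C} (x : (yoneda C κ).obj X ⟶ B) :
      (∃ z, z ≫ m = x) ↔ LiftsLocally (yoneda C κ) f x := by
    rw [← yonedaEquiv_mem_locallyLiftable_iff h]
    constructor
    · rintro ⟨z, rfl⟩
      rw [yonedaEquiv_comp]
      exact (yonedaEquiv z).2
    · exact fun hx ↦ ⟨yonedaEquiv.symm ⟨_, hx⟩, yonedaEquiv.injective <|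
        (yonedaEquiv_comp _ m).trans
          (congr_arg (m.hom.app (op X)) (yonedaEquiv.apply_symm_apply _))⟩
  obtain ⟨e, fac⟩ := exists_lift_of_mono_of_isDense (yoneda C κ) f m fun X a ↦
    (exists_comp_m_iff _).2 ⟨X, 𝟙 X, a, inferInstance, by simp⟩
  refine ⟨_, e, m, fun X z ↦ ?_, inferInstance, fac⟩
  obtain ⟨Y, q, a, hq, ha⟩ := (exists_comp_m_iff (z ≫ m)).1 ⟨z, rfl⟩
  exact ⟨Y, q, a, hq, by rw [← cancel_mono m, Category.assoc, fac, ha, Category.assoc]⟩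

theorem regular_of_isWeaklyRegular (hC : HasCardinalSmallColimits.{w, w, w} C κ)
    (h : IsWeaklyRegular C) : Regular (CardinalInd C κ) := by
  have := hC.hasFiniteColimits
  have := hasFiniteLimits hC
  have := preservesFiniteColimits_yoneda hC
  exact regular_of_exists_image (F := yoneda C κ) h fun _ _ f ↦ exists_image hC h f

theorem isWeaklyRegular_of_regular (hC : HasCardinalSmallColimits.{w, w, w} C κ)
    [Regular (CardinalInd C κ)] : IsWeaklyRegular C := by
  have := hC.hasFiniteColimits
  have := preservesFiniteColimits_yoneda hC
  have := isCardinalPresentable_yoneda_obj hC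
  have := isCardinalFiltered_costructuredArrow hC
  have := hasCardinalFilteredColimits hC
  exact WeaklyRegularInd.isWeaklyRegular_of_regular κ (yoneda C κ)

end CardinalInd

end WeaklyRegularInd

theorem mainTheorem8 (κ : Cardinal.{w}) [Fact κ.IsRegular]
    (C : Type w) [CategoryTheory.SmallCategory.{w} C]
    (hC : WeaklyRegularInd.HasCardinalSmallColimits.{w, w, w} C κ) :
    WeaklyRegularInd.IsWeaklyRegular.{w, w} C ↔
      CategoryTheory.Regular.{w + 1, w} (WeaklyRegularInd.CardinalInd.{w} C κ) :=
  ⟨WeaklyRegularInd.CardinalInd.regular_of_isWeaklyRegular hC,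
    fun _ ↦ WeaklyRegularInd.CardinalInd.isWeaklyRegular_of_regular hC⟩
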